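/- **Proposition ($C^0$ estimate).** Let $n,k,l$ be integers with $2\le k\le n$ and $0\le l\le k-2$. Let $(M,g')$ be a compact $n$-dimensional Riemannian manifold (smooth, without boundary), $I\subset\mathbb R$ an open interval, and $\lambda\in C^2(I)$ with $\lambda>0$ and $\lambda'>0$. Let $\overline M=I\times_\lambda M$ be the warped product with metric $\overline g=dr^2+\lambda(r)^2g'$, put $\zeta=\lambda'/\lambda$, and let $$b(r)=\frac{C_n^k}{C_n^l}\big((n-1)\zeta(r)\big)^{k-l},\qquad r\in I,$$ where $C_n^j$ is the binomial coefficient. Let $r_1<r_2$ be real numbers, and let $f=f(r,u,\nu)$ be a real function defined on a set $\Gamma$ of unit vectors $\nu\in T_{(r,u)}\overline M$, $(r,u)\in\overline M$ (for instance the set of all of them), such that $$f(r,u,\nu)>b(r)\quad\text{for } r\le r_1,\qquad f(r,u,\nu)<b(r)\quad\text{for } r\ge r_2 ,$$ for all $(r,u,\nu)\in\Gamma$. Let $\phi:I\to\mathbb R$ satisfy $\phi>0$, $\phi'<0$, $\phi(r)\ge 1$ for $r\le r_1$ and $\phi(r)\le 1$ for $r\ge r_2$, and for $t\in[0,1]$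 put $$f^t(r,u,\nu)=t\,f(r,u,\nu)+(1-t)\,\phi(r)\,b(r).$$ Let $r:M\to I$ be of class $C^2$ and $\Sigma=\{(r(u),u):u\in M\}\subset\overline M$ its graph, with outward unit normal $\nu$ (the one with $\langle\nu,\partial_r\rangle>0$), all of whose values lie in $\Gamma$. Let $g_{ij}$ be the induced metric of $\Sigma$, $h_{ij}=-\langle\overline\nabla_{X_j}X_i,\nu\rangle$ its second fundamental form for a frame $X_1,\dots,X_n$ of tangential fields, $H=g^{ij}h_{ij}$, $\eta_{ij}=Hg_{ij}-h_{ij}$, and let $\mu(\eta)$ be the $n$-tuple of eigenvalues of $g^{-1}\eta$. Denote by $\sigma_j$ the $j$-th elementary symmetric function ($\sigma_0=1$). Suppose that $\Sigma$ is $(\eta,k)$-convex, i.e. $\sigma_j(\mu(\eta))>0$ on $\Sigma$ for $1\le j\le k$, and that for some $t\in(0,1]$ $$\frac{\sigma_k(\mu(\eta))}{\sigma_l(\mu(\eta))}=f^t\big(r(u),u,\nu\big)\qquad\text{at } (r(u),u), \text{ for every } u\in M .$$ Then $r_1<r(u)<r_2$ for all $u\in M$. -/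

import Mathlib

open scoped Manifold ContDiff

noncomputable section

namespace WarpedGraph

/-! ### Levi-Civita connection and fundamental forms in coordinates

`F` is a coordinate space and `G : F → F → F → ℝ` a metric on (an open part of) it:
`G p A B` is the inner product of `A` and `B` at the point `p`. -/

/-- Christoffel symbols of the first kind (Koszul formula for constant vector fields):
`⟨∇_A B, C⟩ = (A⟨B, C⟩ + B⟨A, C⟩ - C⟨A, B⟩) / 2` at the point `p`. -/
def christoffel {F : Type*} [NormedAddCommGroup F] [NormedSpace ℝ F]
    (G : F → F → F → ℝ) (p A B C : F) : ℝ :=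
  (fderiv ℝ (fun q => G q B C) p A + fderiv ℝ (fun q => G q A C) p B
    - fderiv ℝ (fun q => G q A B) p C) / 2

/-- First fundamental form of the parametrized hypersurface `X` at the parameter `x`. -/
def firstForm {E F : Type*} [NormedAddCommGroup E] [NormedSpace ℝ E]
    [NormedAddCommGroup F] [NormedSpace ℝ F]
    (G : F → F → F → ℝ) (X : E → F) (x v w : E) : ℝ :=
  G (X x) (fderiv ℝ X x v) (fderiv ℝ X x w)

/-- Second fundamental form `h(v, w) = -⟨∇_{X_v} X_w, N⟩` of the parametrized hypersurface `X`
at the parameter `x`, with respect to the normal vector `N`; here `∇_{X_v} X_w` is the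
ambient Levi-Civita derivative, with coordinates `∂_v ∂_w X + Γ(X_v, X_w)`. -/
def secondForm {E F : Type*} [NormedAddCommGroup E] [NormedSpace ℝ E]
    [NormedAddCommGroup F] [NormedSpace ℝ F]
    (G : F → F → F → ℝ) (X : E → F) (N : F) (x v w : E) : ℝ :=
  -(G (X x) (fderiv ℝ (fun y => fderiv ℝ X y w) x v) N
    + christoffel G (X x) (fderiv ℝ X x v) (fderiv ℝ X x w) N)

/-! ### The warped product `I ×_lam M` and radial graphs in it -/

/-- A smooth Riemannian metric on the manifold `M` (of dimension `n`, without boundary). -/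
abbrev Metric (n : ℕ) (M : Type*) [TopologicalSpace M]
    [ChartedSpace (EuclideanSpace ℝ (Fin n)) M] [IsManifold (𝓡 n) ∞ M] :=
  Bundle.ContMDiffRiemannianMetric (𝓡 n) ∞ (EuclideanSpace ℝ (Fin n))
    (fun u : M => TangentSpace (𝓡 n) u)

/-- Tangent space of `I ×_lam M` at a point `(ρ, u)`: the pair `(a, v)` is `a ∂_r + v`. -/
abbrev AmbientTangent (n : ℕ) {M : Type*} [TopologicalSpace M]
    [ChartedSpace (EuclideanSpace ℝ (Fin n)) M] (u : M) : Type :=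
  ℝ × TangentSpace (𝓡 n) u

section

variable {n : ℕ} {M : Type*} [TopologicalSpace M]
  [ChartedSpace (EuclideanSpace ℝ (Fin n)) M] [IsManifold (𝓡 n) ∞ M]

/-- The warped product metric `dr² + lam(r)² g` at the point `(ρ, u)`. -/
def ambientInner (lam : ℝ → ℝ) (g : Metric n M) (ρ : ℝ) (u : M) (A B : AmbientTangent n u) : ℝ :=
  A.1 * B.1 + lam ρ ^ 2 * g.inner u A.2 B.2

/-- `N` is the outward (`⟨N, ∂_r⟩ > 0`) unit normal at `(r u, u)` of the graph of `r`,
whose tangent vectors are `dr(v) ∂_r + v`. -/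
structure IsOutwardUnitNormal (lam : ℝ → ℝ) (g : Metric n M) (r : M → ℝ) (u : M)
    (N : AmbientTangent n u) : Prop where
  orthogonal : ∀ v : TangentSpace (𝓡 n) u,
    ambientInner lam g (r u) u N (mfderiv (𝓡 n) 𝓘(ℝ, ℝ) r u v, v) = 0
  unit : ambientInner lam g (r u) u N N = 1
  outward : 0 < ambientInner lam g (r u) u N (1, 0)

/-- The warped product metric in the coordinates `(ρ, x)` of `ℝ × EuclideanSpace ℝ (Fin n)`,
where `x` are the coordinates of `M` in the preferred chart at `u₀`. -/
def coordMetric (lam : ℝ → ℝ) (g : Metric n M) (u₀ : M)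
    (p A B : ℝ × EuclideanSpace ℝ (Fin n)) : ℝ :=
  let D := mfderiv 𝓘(ℝ, EuclideanSpace ℝ (Fin n)) (𝓡 n) (extChartAt (𝓡 n) u₀).symm p.2
  ambientInner lam g p.1 ((extChartAt (𝓡 n) u₀).symm p.2) (A.1, D A.2) (B.1, D B.2)

/-- The graph of `r` in the same coordinates: `x ↦ (r(x), x)`. -/
def coordGraph (r : M → ℝ) (u₀ : M) (x : EuclideanSpace ℝ (Fin n)) :
    ℝ × EuclideanSpace ℝ (Fin n) :=
  (r ((extChartAt (𝓡 n) u₀).symm x), x)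

/-- The coordinates of an ambient tangent vector at a point over `u₀`. -/
def coordVector (u₀ : M) (N : AmbientTangent n u₀) : ℝ × EuclideanSpace ℝ (Fin n) :=
  (N.1, mfderiv (𝓡 n) 𝓘(ℝ, EuclideanSpace ℝ (Fin n)) (extChartAt (𝓡 n) u₀) u₀ N.2)

/-- The matrix `(g_ij)` of the induced metric of the graph over `u`. -/
def gMatrix (lam : ℝ → ℝ) (g : Metric n M) (r : M → ℝ) (u : M) : Matrix (Fin n) (Fin n) ℝ :=
  Matrix.of fun i j => firstForm (coordMetric lam g u) (coordGraph r u) (extChartAt (𝓡 n) u u)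
    (EuclideanSpace.single i 1) (EuclideanSpace.single j 1)

/-- The matrix `(h_ij)` of the second fundamental form of the graph over `u`, for the normal `N`. -/
def hMatrix (lam : ℝ → ℝ) (g : Metric n M) (r : M → ℝ) (u : M) (N : AmbientTangent n u) :
    Matrix (Fin n) (Fin n) ℝ :=
  Matrix.of fun i j => secondForm (coordMetric lam g u) (coordGraph r u) (coordVector u N)
    (extChartAt (𝓡 n) u u) (EuclideanSpace.single i 1) (EuclideanSpace.single j 1)

/-- Mean curvature `H = g^{ij} h_ij` (the sum of the principal curvatures). -/
def meanCurvature (lam : ℝ → ℝ) (g : Metric n M) (r : M → ℝ) (u : M)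
    (N : AmbientTangent n u) : ℝ :=
  ((gMatrix lam g r u)⁻¹ * hMatrix lam g r u N).trace

/-- The matrix of `η_ij = H g_ij - h_ij`. -/
def etaMatrix (lam : ℝ → ℝ) (g : Metric n M) (r : M → ℝ) (u : M)
    (N : AmbientTangent n u) : Matrix (Fin n) (Fin n) ℝ :=
  meanCurvature lam g r u N • gMatrix lam g r u - hMatrix lam g r u N

/-- `μ(η)`: the eigenvalues of `g⁻¹ η`, with multiplicity. -/
def etaEigenvalues (lam : ℝ → ℝ) (g : Metric n M) (r : M → ℝ) (u : M)
    (N : AmbientTangent n u) : Multiset ℝ :=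
  ((gMatrix lam g r u)⁻¹ * etaMatrix lam g r u N).charpoly.roots

end

/-- The Garding cone `Γ_k`: `σ_j(μ) > 0` for `1 ≤ j ≤ k`. -/
def InGardingCone (k : ℕ) (μ : Multiset ℝ) : Prop :=
  ∀ j : ℕ, 1 ≤ j → j ≤ k → 0 < μ.esymm j

/-- The barrier `(C_n^k / C_n^l) ((n-1) ζ(ρ))^{k-l}`, with `ζ = lam' / lam`. -/
def barrier (n k l : ℕ) (lam : ℝ → ℝ) (ρ : ℝ) : ℝ :=
  ((n.choose k : ℝ) / (n.choose l : ℝ)) * (((n : ℝ) - 1) * (deriv lam ρ / lam ρ)) ^ (k - l)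

/-- The conditions on the auxiliary function `φ` of the homotopy. -/
structure IsHomotopyWeight (I : Set ℝ) (r₁ r₂ : ℝ) (φ : ℝ → ℝ) : Prop where
  pos : ∀ ρ ∈ I, 0 < φ ρ
  one_le : ∀ ρ ∈ I, ρ ≤ r₁ → 1 ≤ φ ρ
  le_one : ∀ ρ ∈ I, r₂ ≤ ρ → φ ρ ≤ 1
  deriv_neg : ∀ ρ ∈ I, deriv φ ρ < 0

end WarpedGraph

end

namespace WarpedGraph

/-! ### Elementary symmetric functions on the Garding cone -/

open Polynomial

/-! The proof is a maximum principle: compare the graph with the slices `r = const`, on which every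
eigenvalue of `g⁻¹ η` is `c = (n-1) ζ` and hence `σ_k / σ_l = b`.

At a minimum of `r` one has `dr = 0`, the normal is `∂_r`, and `h = ζ g - Hess r`. Diagonalizing `g`
and `Hess r` simultaneously, with eigenvalues `q_i` of `g⁻¹ Hess r`, gives `μ_i = c - ∑_{j ≠ i} q_j`
(`exists_etaEigenvalues_eq_of_critical`). There `q ≥ 0`, so every `μ_i ≤ c`, and on the Garding cone
this forces `σ_k / σ_l ≤ b` (`InGardingCone.esymm_quotient_le`). If the minimum value were at most
`r₁`, then `f > b`, `φ ≥ 1` and `t > 0` would give `f^t > b`, contradicting the equation. At a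
maximum all inequalities reverse.

The algebraic comparison multiplies one-step bounds on `σ_{j+1} / σ_j`. These come from the identity
`∑ (c - a) σ_j(s \ a) = c (N - j) σ_j - (j+1) σ_{j+1}`, where `N` is the number of entries of `s`,
and from the positivity of `σ_j(s \ a)` for `j < k` on `Γ_k`, a consequence of Newton's inequality.
-/

theorem esymm_cons (a : ℝ) (s : Multiset ℝ) (j : ℕ) :
    (a ::ₘ s).esymm (j + 1) = s.esymm (j + 1) + a * s.esymm j := by
  simp [Multiset.esymm, Multiset.powersetCard_cons, Multiset.map_map, Multiset.sum_map_mul_left]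

theorem esymm_zero (s : Multiset ℝ) : s.esymm 0 = 1 := by
  simp [Multiset.esymm]

theorem esymm_eq_zero_of_card_lt (s : Multiset ℝ) {j : ℕ} (h : Multiset.card s < j) :
    s.esymm j = 0 := by
  simp [Multiset.esymm, Multiset.powersetCard_eq_empty _ h]

theorem esymm_eq_erase_add {s : Multiset ℝ} {a : ℝ} (ha : a ∈ s) (j : ℕ) :
    s.esymm (j + 1) = (s.erase a).esymm (j + 1) + a * (s.erase a).esymm j := by
  conv_lhs => rw [← Multiset.cons_erase ha]
  exact esymm_cons _ _ _

/-- Compare coefficients in the derivative of `∏ (X + a)`, which is the sum of the products with one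
factor removed. The case `j = card s`, where both sides vanish, is needed for the top degree of the
next identity. -/
theorem sum_esymm_erase (s : Multiset ℝ) {j : ℕ} (hj : j ≤ Multiset.card s) :
    (s.map fun a => (s.erase a).esymm j).sum = ((Multiset.card s : ℝ) - j) * s.esymm j := by
  rcases hj.eq_or_lt with h | h
  · rw [h, sub_self, zero_mul]
    apply Multiset.sum_eq_zero
    intro x hx
    obtain ⟨a, ha, rfl⟩ := Multiset.mem_map.1 hx
    apply esymm_eq_zero_of_card_lt
    rw [Multiset.card_erase_of_mem ha]
    have := Multiset.card_pos_iff_exists_mem.2 ⟨a, ha⟩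
    exact Nat.pred_lt this.ne'
  · have key := congrArg (fun p : ℝ[X] => p.coeff (Multiset.card s - 1 - j))
      (derivative_prod (s := s) (f := fun a : ℝ => (X + C a : ℝ[X])))
    simp only [coeff_derivative] at key
    rw [Multiset.prod_X_add_C_coeff _ (by omega)] at key
    have e1 : Multiset.card s - (Multiset.card s - 1 - j + 1) = j := by omega
    have e2 : ((Multiset.card s - 1 - j : ℕ) : ℝ) + 1 = (Multiset.card s : ℝ) - j := by
      rw [Nat.sub_sub, Nat.cast_sub (by omega)]
      push_cast
      ring
    rw [e1, e2] at key
    rw [mul_comm, key, ← lcoeff_apply, map_multiset_sum, Multiset.map_map]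
    congr 1
    apply Multiset.map_congr rfl
    intro a ha
    have hc : Multiset.card (s.erase a) = Multiset.card s - 1 := Multiset.card_erase_of_mem ha
    simp only [Function.comp_apply, derivative_add, derivative_X, derivative_C, add_zero, mul_one,
      lcoeff_apply]
    rw [Multiset.prod_X_add_C_coeff _ (by omega), hc]
    congr 1
    omega

/-- Since `a σ_j(s \ a) = σ_{j+1}(s) - σ_{j+1}(s \ a)`, the previous identity in degrees `j` and `j
+ 1` evaluates both parts of the sum. When `c` bounds all entries from one side, the left side has a
sign as soon as the `σ_j(s \ a)` are positive. -/
theorem sum_sub_mul_esymm_erase (s : Multiset ℝ) (c : ℝ) {j : ℕ} (hj : j < Multiset.card s) :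
    (s.map fun a => (c - a) * (s.erase a).esymm j).sum
      = c * ((Multiset.card s : ℝ) - j) * s.esymm j - (j + 1) * s.esymm (j + 1) := by
  have h1 := sum_esymm_erase s hj.le
  have h2 := sum_esymm_erase s (j := j + 1) hj
  have h3 : (s.map fun a => a * (s.erase a).esymm j).sum
      = (s.map fun a => s.esymm (j + 1) - (s.erase a).esymm (j + 1)).sum := by
    congr 1
    apply Multiset.map_congr rfl
    intro a ha
    rw [esymm_eq_erase_add ha]
    ring
  rw [Multiset.sum_map_sub, h2, Multiset.map_const', Multiset.sum_replicate] at h3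
  simp only [sub_mul, Multiset.sum_map_sub, Multiset.sum_map_mul_left]
  rw [h1, h3]
  push_cast
  simp only [nsmul_eq_mul]
  ring

/-- By Rolle's theorem differentiation loses at most one real root, counted with multiplicity, which
leaves as many as the degree of the derivative. -/
theorem splits_derivative {p : ℝ[X]} (hp : p.Splits) : (derivative p).Splits := by
  rw [splits_iff_card_roots] at *
  have h1 := card_roots_le_derivative p
  have h2 := card_roots' (derivative p)
  have h3 := natDegree_derivative p
  omega

/-- This is the concavity of `log |p|`, cleared of denominators. For `p = (X - a) q` one has `p'² -
p p'' = (x - a)² (q'² - q q'') + q²`, so the inequality survives each new factor. -/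
theorem laguerre_inequality_multiset (s : Multiset ℝ) (x : ℝ) :
    (s.map fun a => (X - C a : ℝ[X])).prod.eval x *
        (derivative (derivative (s.map fun a => (X - C a : ℝ[X])).prod)).eval x
      ≤ (derivative (s.map fun a => (X - C a : ℝ[X])).prod).eval x ^ 2 := by
  induction s using Multiset.induction_on with
  | empty => simp
  | cons a s ih =>
    simp only [Multiset.map_cons, Multiset.prod_cons, derivative_mul, derivative_sub, derivative_X,
      derivative_C, sub_zero, one_mul, derivative_add, eval_add, eval_mul, eval_sub, eval_X, eval_C]
    nlinarith [mul_le_mul_of_nonneg_left ih (sq_nonneg (x - a)),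
      sq_nonneg ((s.map fun a => (X - C a : ℝ[X])).prod.eval x)]

theorem laguerre_inequality {p : ℝ[X]} (hp : p.Splits) (x : ℝ) :
    p.eval x * (derivative (derivative p)).eval x ≤ (derivative p).eval x ^ 2 := by
  have h := laguerre_inequality_multiset p.roots x
  rw [hp.eq_prod_roots]
  simp only [derivative_mul, derivative_C, zero_mul, zero_add, eval_mul, eval_C]
  nlinarith [mul_le_mul_of_nonneg_left h (sq_nonneg p.leadingCoeff)]

/-- Differentiating `∏ (X + a)` exactly `d = card s - m - 2` times keeps all roots real and brings
`σ_{m+2}`, `σ_{m+1}`, `σ_m` to the three lowest coefficients. Laguerre's inequality at `0` then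
gives the constant `(d+1)/(d+2)`, which is weakened to `1`. -/
theorem newton_inequality (s : Multiset ℝ) (m : ℕ) :
    s.esymm m * s.esymm (m + 2) ≤ s.esymm (m + 1) ^ 2 := by
  by_cases hm : Multiset.card s < m + 2
  · rw [esymm_eq_zero_of_card_lt s hm, mul_zero]
    positivity
  obtain ⟨d, hd⟩ : ∃ d, Multiset.card s = d + m + 2 := ⟨Multiset.card s - (m + 2), by omega⟩
  set P : ℝ[X] := (s.map fun a => X + C a).prod with hP
  have hs : P.Splits := by
    apply Splits.multisetProd
    intro f hf
    obtain ⟨a, -, rfl⟩ := Multiset.mem_map.1 hf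
    exact Splits.X_add_C a
  have hQ : (derivative^[d] P).Splits :=
    Nat.rec hs (fun i hi => by rw [Function.iterate_succ_apply']; exact splits_derivative hi) d
  have h := laguerre_inequality hQ 0
  simp only [← coeff_zero_eq_eval_zero, coeff_derivative, coeff_iterate_derivative] at h
  rw [hP, Multiset.prod_X_add_C_coeff _ (by omega), Multiset.prod_X_add_C_coeff _ (by omega),
    Multiset.prod_X_add_C_coeff _ (by omega)] at h
  have e0 : Multiset.card s - (0 + d) = m + 2 := by omega
  have e1 : Multiset.card s - (0 + 1 + d) = m + 1 := by omega
  have e2 : Multiset.card s - (0 + 1 + 1 + d) = m := by omega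
  have f0 : (0 + d).descFactorial d = d.factorial := by
    rw [zero_add, Nat.descFactorial_self]
  have f1 : (0 + 1 + d).descFactorial d = (d + 1) * d.factorial := by
    have := Nat.factorial_mul_descFactorial (show d ≤ 0 + 1 + d by omega)
    rw [show 0 + 1 + d - d = 1 by omega, show 0 + 1 + d = d + 1 by omega, Nat.factorial_one,
      one_mul, Nat.factorial_succ] at this
    rw [show 0 + 1 + d = d + 1 by omega, this]
  have f2 : 2 * (0 + 1 + 1 + d).descFactorial d = (d + 2) * ((d + 1) * d.factorial) := by
    have := Nat.factorial_mul_descFactorial (show d ≤ 0 + 1 + 1 + d by omega)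
    rw [show 0 + 1 + 1 + d - d = 2 by omega, show 0 + 1 + 1 + d = d + 1 + 1 by omega,
      Nat.factorial_two, Nat.factorial_succ, Nat.factorial_succ] at this
    rw [show 0 + 1 + 1 + d = d + 1 + 1 by omega, this]
  have f2' : (2 : ℝ) * ((0 + 1 + 1 + d).descFactorial d : ℕ)
      = (d + 2) * ((d + 1) * (d.factorial : ℕ)) := by exact_mod_cast f2
  rw [e0, e1, e2, f0, f1] at h
  simp only [nsmul_eq_mul] at h
  push_cast at h
  have hF : (0 : ℝ) < d.factorial := by exact_mod_cast d.factorial_pos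
  -- The common factor `d!² (d+1)` is isolated so that it can be cancelled.
  have h' : ((d.factorial : ℝ) ^ 2 * (d + 1)) * ((d + 2) * (s.esymm m * s.esymm (m + 2)))
      ≤ ((d.factorial : ℝ) ^ 2 * (d + 1)) * ((d + 1) * s.esymm (m + 1) ^ 2) := by
    have hx : ((d.factorial : ℝ) ^ 2 * (d + 1)) * ((d + 2) * (s.esymm m * s.esymm (m + 2)))
      = (d.factorial : ℝ) * s.esymm (m + 2) * s.esymm m
        * ((d + 2) * ((d + 1) * (d.factorial : ℕ))) := by ring
    rw [hx, ← f2']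
    nlinarith [h]
  have h'' := le_of_mul_le_mul_left h' (by positivity)
  by_contra! hcon
  have hd0 : (0 : ℝ) ≤ d := d.cast_nonneg
  nlinarith [sq_nonneg (s.esymm (m + 1))]

theorem InGardingCone.esymm_pos {k : ℕ} {s : Multiset ℝ} (h : InGardingCone k s) {j : ℕ}
    (hj : j ≤ k) : 0 < s.esymm j := by
  rcases j.eq_zero_or_pos with rfl | h0
  · rw [esymm_zero]
    exact one_pos
  · exact h j h0 hj

/-- Let `A, B, C` be `σ_m, σ_{m+1}, σ_{m+2}` of `s`, with `A > 0` by induction. If `B ≤ 0`, then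
adding `A (C + aB) > 0` and `-B (B + aA) ≥ 0` gives `AC > B²`, against Newton's inequality. -/
theorem InGardingCone.esymm_pos_of_cons {k : ℕ} {a : ℝ} {s : Multiset ℝ}
    (h : InGardingCone k (a ::ₘ s)) {j : ℕ} (hj : j < k) : 0 < s.esymm j := by
  induction j with
  | zero => rw [esymm_zero]; exact one_pos
  | succ m ih =>
    have hm := ih (by omega)
    by_contra! hneg
    have h1 := h.esymm_pos (j := m + 1) (by omega)
    have h2 := h.esymm_pos (j := m + 2) (by omega)
    rw [esymm_cons] at h1 h2
    have h3 := newton_inequality s m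
    nlinarith [mul_pos hm h2, mul_nonneg (neg_nonneg.2 hneg) h1.le]

theorem InGardingCone.esymm_erase_pos {k : ℕ} {a : ℝ} {s : Multiset ℝ}
    (h : InGardingCone k s) (ha : a ∈ s) {j : ℕ} (hj : j < k) : 0 < (s.erase a).esymm j := by
  rw [← Multiset.cons_erase ha] at h
  exact h.esymm_pos_of_cons hj

theorem choose_succ_mul_cast {n j : ℕ} (hj : j ≤ n) :
    (n.choose (j + 1) : ℝ) * (j + 1) = n.choose j * ((n : ℝ) - j) := by
  rw [← Nat.cast_sub hj]
  exact_mod_cast Nat.choose_succ_right_eq n j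

/-- With `N = card s`, each step satisfies `σ_{j+1} / σ_j ≤ c (N - j)/(j + 1)`. The product of these
constants over `l ≤ j < k` telescopes to the ratio of binomial coefficients times `c ^ (k - l)`, the
value when all entries equal `c`. -/
theorem InGardingCone.esymm_quotient_le {k l : ℕ} {s : Multiset ℝ} (h : InGardingCone k s)
    (hks : k ≤ Multiset.card s) (hl : l ≤ k) {c : ℝ} (hc : 0 < c) (hs : ∀ a ∈ s, a ≤ c) :
    s.esymm k / s.esymm l
      ≤ ((Multiset.card s).choose k : ℝ) / (Multiset.card s).choose l * c ^ (k - l) := by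
  induction k, hl using Nat.le_induction with
  | base =>
    have h0 : (0 : ℝ) < (Multiset.card s).choose l := by exact_mod_cast Nat.choose_pos hks
    rw [div_self (h.esymm_pos le_rfl).ne', div_self h0.ne']
    simp
  | succ k hlk ih =>
    have ih' := ih (fun j h1 h2 => h j h1 (by omega)) (by omega)
    have hl0 := h.esymm_pos (j := l) (by omega)
    have h0 : (0 : ℝ) < (Multiset.card s).choose l := by
      exact_mod_cast Nat.choose_pos (by omega)
    have key := sum_sub_mul_esymm_erase s c (j := k) hks
    -- Here `s` lies in `Γ_{k+1}`, so `σ_k` stays positive after removing any entry.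
    have hnn : 0 ≤ (s.map fun a => (c - a) * (s.erase a).esymm k).sum := by
      apply Multiset.sum_nonneg
      intro x hx
      obtain ⟨a, ha, rfl⟩ := Multiset.mem_map.1 hx
      exact mul_nonneg (sub_nonneg.2 (hs a ha)) (h.esymm_erase_pos ha (by omega)).le
    have hch := choose_succ_mul_cast (n := Multiset.card s) (j := k) (by omega)
    have hkn : (0 : ℝ) ≤ (Multiset.card s : ℝ) - k := by
      rw [sub_nonneg]; exact_mod_cast (by omega : k ≤ Multiset.card s)
    rw [div_mul_eq_mul_div, div_le_div_iff₀ hl0 h0] at ih' ⊢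
    rw [Nat.succ_sub hlk, pow_succ]
    have hk1 : (0 : ℝ) < k + 1 := by positivity
    refine le_of_mul_le_mul_left ?_ hk1
    calc ((k : ℝ) + 1) * (s.esymm (k + 1) * (Multiset.card s).choose l)
        ≤ (c * ((Multiset.card s : ℝ) - k) * s.esymm k) * (Multiset.card s).choose l := by
          rw [← mul_assoc]
          exact mul_le_mul_of_nonneg_right (by linarith) h0.le
      _ = (c * ((Multiset.card s : ℝ) - k)) * (s.esymm k * (Multiset.card s).choose l) := by ring
      _ ≤ (c * ((Multiset.card s : ℝ) - k))
            * ((Multiset.card s).choose k * c ^ (k - l) * s.esymm l) :=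
          mul_le_mul_of_nonneg_left ih' (mul_nonneg hc.le hkn)
      _ = ((Multiset.card s).choose k * ((Multiset.card s : ℝ) - k))
            * (c ^ (k - l) * c * s.esymm l) := by ring
      _ = _ := by rw [← hch]; ring

/-- The same telescoping applies; the factors `c - a` are now nonpositive, which reverses each
one-step bound. -/
theorem InGardingCone.le_esymm_quotient {k l : ℕ} {s : Multiset ℝ} (h : InGardingCone k s)
    (hks : k ≤ Multiset.card s) (hl : l ≤ k) {c : ℝ} (hc : 0 < c) (hs : ∀ a ∈ s, c ≤ a) :
    ((Multiset.card s).choose k : ℝ) / (Multiset.card s).choose l * c ^ (k - l)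
      ≤ s.esymm k / s.esymm l := by
  induction k, hl using Nat.le_induction with
  | base =>
    have h0 : (0 : ℝ) < (Multiset.card s).choose l := by exact_mod_cast Nat.choose_pos hks
    rw [div_self (h.esymm_pos le_rfl).ne', div_self h0.ne']
    simp
  | succ k hlk ih =>
    have ih' := ih (fun j h1 h2 => h j h1 (by omega)) (by omega)
    have hl0 := h.esymm_pos (j := l) (by omega)
    have h0 : (0 : ℝ) < (Multiset.card s).choose l := by
      exact_mod_cast Nat.choose_pos (by omega)
    have key := sum_sub_mul_esymm_erase s c (j := k) hks
    have hnn : (s.map fun a => (c - a) * (s.erase a).esymm k).sum ≤ 0 := by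
      rw [← neg_nonneg, ← Multiset.sum_map_neg]
      apply Multiset.sum_nonneg
      intro x hx
      obtain ⟨a, ha, rfl⟩ := Multiset.mem_map.1 hx
      rw [← neg_mul, neg_sub]
      exact mul_nonneg (sub_nonneg.2 (hs a ha)) (h.esymm_erase_pos ha (by omega)).le
    have hch := choose_succ_mul_cast (n := Multiset.card s) (j := k) (by omega)
    have hkn : (0 : ℝ) ≤ (Multiset.card s : ℝ) - k := by
      rw [sub_nonneg]; exact_mod_cast (by omega : k ≤ Multiset.card s)
    rw [div_mul_eq_mul_div, div_le_div_iff₀ h0 hl0] at ih' ⊢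
    rw [Nat.succ_sub hlk, pow_succ]
    have hk1 : (0 : ℝ) < k + 1 := by positivity
    refine le_of_mul_le_mul_left ?_ hk1
    calc ((k : ℝ) + 1) * ((Multiset.card s).choose (k + 1) * (c ^ (k - l) * c) * s.esymm l)
        = ((Multiset.card s).choose (k + 1) * ((k : ℝ) + 1))
            * (c ^ (k - l) * c * s.esymm l) := by ring
      _ = (c * ((Multiset.card s : ℝ) - k))
            * ((Multiset.card s).choose k * c ^ (k - l) * s.esymm l) := by rw [hch]; ring
      _ ≤ (c * ((Multiset.card s : ℝ) - k)) * (s.esymm k * (Multiset.card s).choose l) :=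
          mul_le_mul_of_nonneg_left ih' (mul_nonneg hc.le hkn)
      _ = (c * ((Multiset.card s : ℝ) - k) * s.esymm k) * (Multiset.card s).choose l := by ring
      _ ≤ ((k : ℝ) + 1) * (s.esymm (k + 1) * (Multiset.card s).choose l) := by
          rw [← mul_assoc]
          exact mul_le_mul_of_nonneg_right (by linarith) h0.le

end WarpedGraph

namespace WarpedGraph

/-! ### Simultaneous diagonalization and the eigenvalues of `g⁻¹ η` -/

open Matrix in
-- Rescaling an orthonormal eigenbasis of `G` by `d_i^{-1/2}` turns `G` into the identity. A further
-- orthogonal change of basis diagonalizes the transformed `R` and preserves the identity.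
theorem exists_simultaneous_diagonalization {m : Type*} [Fintype m] [DecidableEq m]
    {G R : Matrix m m ℝ} (hG : G.PosDef) (hR : R.IsHermitian) :
    ∃ (V : Matrix m m ℝ) (q : m → ℝ), Vᴴ * G * V = 1 ∧ Vᴴ * R * V = diagonal q := by
  obtain ⟨W, hW⟩ : ∃ W : Matrix m m ℝ, Wᴴ * G * W = 1 := by
    have h := hG.isHermitian.conjStarAlgAut_star_eigenvectorUnitary
    rw [Unitary.conjStarAlgAut_star_apply] at h
    set U : Matrix m m ℝ := (hG.isHermitian.eigenvectorUnitary : Matrix m m ℝ) with hU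
    set d := hG.isHermitian.eigenvalues with hd
    refine ⟨U * diagonal fun i => (√(d i))⁻¹, ?_⟩
    have e : (U * diagonal fun i => (√(d i))⁻¹)ᴴ * G * (U * diagonal fun i => (√(d i))⁻¹)
        = diagonal (fun i => (√(d i))⁻¹) * (star U * G * U) * diagonal fun i => (√(d i))⁻¹ := by
      rw [conjTranspose_mul, diagonal_conjTranspose, star_eq_conjTranspose]
      simp only [Matrix.mul_assoc]
      rfl
    rw [e, h, diagonal_mul_diagonal, diagonal_mul_diagonal, ← diagonal_one]
    congr 1
    funext i
    have hi : 0 < d i := hG.eigenvalues_pos i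
    have hs := Real.mul_self_sqrt hi.le
    have hs0 := (Real.sqrt_pos.2 hi).ne'
    simp only [Function.comp_apply, RCLike.ofReal_real_eq_id, id_eq]
    field_simp
    rw [sq, hs]
  have hK : (Wᴴ * R * W).IsHermitian := isHermitian_conjTranspose_mul_mul W hR
  have h := hK.conjStarAlgAut_star_eigenvectorUnitary
  rw [Unitary.conjStarAlgAut_star_apply] at h
  have hUU : star (hK.eigenvectorUnitary : Matrix m m ℝ) * hK.eigenvectorUnitary = 1 :=
    Unitary.coe_star_mul_self _
  refine ⟨W * (hK.eigenvectorUnitary : Matrix m m ℝ), hK.eigenvalues, ?_, ?_⟩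
  · have e (O : Matrix m m ℝ) : (W * O)ᴴ * G * (W * O) = star O * (Wᴴ * G * W) * O := by
      rw [conjTranspose_mul, star_eq_conjTranspose]
      simp only [Matrix.mul_assoc]
    rw [e, hW, Matrix.mul_one, hUU]
  · have e (O : Matrix m m ℝ) : (W * O)ᴴ * R * (W * O) = star O * (Wᴴ * R * W) * O := by
      rw [conjTranspose_mul, star_eq_conjTranspose]
      simp only [Matrix.mul_assoc]
    rw [e, h]
    rfl

open Matrix Polynomial in
-- From `Vᴴ G V = 1` follows `V⁻¹ = Vᴴ G`, so the congruence is also a similarity: `G⁻¹ R = V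
-- diag(q) V⁻¹`. For `h = ζ G - R` the operator is `((m-1) ζ - ∑ q) 1 + G⁻¹ R`, with `m` the size of
-- the matrices. Writing `q i` as a value of the quadratic form of `R` lets the sign of a Hessian
-- pass to the `q i`.
theorem exists_roots_charpoly_eta {m : Type*} [Fintype m] [DecidableEq m]
    {G R : Matrix m m ℝ} (hG : G.PosDef) (hR : R.IsHermitian) (ζ : ℝ) :
    ∃ q : m → ℝ,
      (G⁻¹ * ((G⁻¹ * (ζ • G - R)).trace • G - (ζ • G - R))).charpoly.roots
        = Finset.univ.val.map
          (fun i => ((Fintype.card m : ℝ) - 1) * ζ - (∑ j, q j - q i)) ∧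
      ∀ i, ∃ x : m → ℝ, q i = x ⬝ᵥ R *ᵥ x := by
  obtain ⟨V, q, h1, h2⟩ := exists_simultaneous_diagonalization hG hR
  have hVl : (Vᴴ * G) * V = 1 := h1
  have hVr : V * (Vᴴ * G) = 1 := mul_eq_one_comm.1 hVl
  have hGi : G⁻¹ = V * Vᴴ := Matrix.inv_eq_left_inv (by rw [Matrix.mul_assoc]; exact hVr)
  have hGG : G⁻¹ * G = 1 := by rw [hGi, Matrix.mul_assoc]; exact hVr
  have hGR : G⁻¹ * R = V * diagonal q * (Vᴴ * G) := by
    rw [← h2, hGi]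
    calc V * Vᴴ * R = V * Vᴴ * R * (V * (Vᴴ * G)) := by rw [hVr, Matrix.mul_one]
      _ = _ := by simp only [Matrix.mul_assoc]
  have htr : (G⁻¹ * R).trace = ∑ j, q j := by
    rw [hGR, Matrix.trace_mul_comm, ← Matrix.mul_assoc, hVl, Matrix.one_mul, trace_diagonal]
  refine ⟨q, ?_, fun i => ⟨V *ᵥ Pi.single i 1, ?_⟩⟩
  · have hM : G⁻¹ * ((G⁻¹ * (ζ • G - R)).trace • G - (ζ • G - R))
        = V * (diagonal (fun i => ((Fintype.card m : ℝ) - 1) * ζ - (∑ j, q j - q i))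
          * (Vᴴ * G)) := by
      have hd : diagonal (fun i => ((Fintype.card m : ℝ) - 1) * ζ - (∑ j, q j - q i))
          = (((Fintype.card m : ℝ) - 1) * ζ - ∑ j, q j) • (1 : Matrix m m ℝ) + diagonal q := by
        rw [← diagonal_one, ← diagonal_smul, diagonal_add]
        congr 1
        funext i
        simp
        ring
      rw [hd, Matrix.add_mul, Matrix.mul_add, ← Matrix.mul_assoc V (diagonal q), ← hGR,
        Matrix.smul_mul, Matrix.mul_smul, Matrix.one_mul, hVr]
      rw [Matrix.mul_sub, Matrix.mul_sub, Matrix.mul_smul, Matrix.mul_smul, hGG, trace_sub, htr,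
        trace_smul, trace_one, smul_eq_mul, sub_mul, sub_smul, sub_smul, sub_smul, one_mul,
        mul_comm ζ]
      abel
    rw [hM, charpoly_mul_comm, Matrix.mul_assoc, hVl, Matrix.mul_one, charpoly_diagonal,
      Polynomial.roots_prod _ _ (Finset.prod_ne_zero_iff.2 fun i _ => X_sub_C_ne_zero _)]
    simp only [roots_X_sub_C, Multiset.bind_singleton]
  · have := congrFun (congrFun h2 i) i
    rw [diagonal_apply_eq] at this
    rw [← this, mulVec_mulVec, dotProduct_mulVec, vecMul_mulVec]
    simp [Matrix.mul_assoc]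

end WarpedGraph

namespace WarpedGraph

/-! ### The Hessian at a local extremum -/

open Filter Topology

variable {E : Type*} [NormedAddCommGroup E] [NormedSpace ℝ E]

theorem eventually_differentiableAt_of_contDiffAt_two {f : E → ℝ} {x : E}
    (hf : ContDiffAt ℝ 2 f x) : ∀ᶠ y in 𝓝 x, DifferentiableAt ℝ f y :=
  (hf.eventually (by simp)).mono fun _ hy => hy.differentiableAt (by simp)

theorem differentiableAt_fderiv_of_contDiffAt_two {f : E → ℝ} {x : E}
    (hf : ContDiffAt ℝ 2 f x) : DifferentiableAt ℝ (fderiv ℝ f) x :=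
  (hf.fderiv_right (m := 1) (by norm_num)).differentiableAt (by simp)

theorem fderiv_fderiv_apply_comm {f : E → ℝ} {x : E} (hf : ContDiffAt ℝ 2 f x) (v w : E) :
    fderiv ℝ (fun y => fderiv ℝ f y w) x v = fderiv ℝ (fun y => fderiv ℝ f y v) x w := by
  have hd := differentiableAt_fderiv_of_contDiffAt_two hf
  rw [fderiv_clm_apply hd (by fun_prop), fderiv_clm_apply hd (by fun_prop)]
  simpa using hf.isSymmSndFDerivAt (by simp) v w

/-- Restrict to the line through `x` in direction `v`. A negative second derivative would make the
minimum a strict maximum along it; the contradiction is reached by local constancy. -/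
theorem fderiv_fderiv_apply_nonneg_of_isLocalMin {f : E → ℝ} {x : E} (hmin : IsLocalMin f x)
    (hf : ContDiffAt ℝ 2 f x) (v : E) : 0 ≤ fderiv ℝ (fun y => fderiv ℝ f y v) x v := by
  by_contra! hneg
  have hline : ∀ s : ℝ, HasDerivAt (fun s : ℝ => x + s • v) v s := fun s => by
    simpa using ((hasDerivAt_id s).smul_const v).const_add x
  have hcont : ContinuousAt (fun s : ℝ => x + s • v) 0 := (hline 0).continuousAt
  have h0 : x + (0 : ℝ) • v = x := by simp
  have htend : Tendsto (fun s : ℝ => x + s • v) (𝓝 0) (𝓝 x) := by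
    simpa only [ContinuousAt, h0] using hcont
  set φ : ℝ → ℝ := fun s => f (x + s • v) with hφ
  have hd1 : deriv φ =ᶠ[𝓝 0] fun s => fderiv ℝ f (x + s • v) v := by
    filter_upwards [htend.eventually (eventually_differentiableAt_of_contDiffAt_two hf)] with s hs
    exact (hs.hasFDerivAt.comp_hasDerivAt s (hline s)).deriv
  have hd2 : deriv (deriv φ) 0 = fderiv ℝ (fun y => fderiv ℝ f y v) x v := by
    rw [hd1.deriv_eq]
    have hD : DifferentiableAt ℝ (fun y => fderiv ℝ f y v) (x + (0 : ℝ) • v) := by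
      rw [h0]
      exact (differentiableAt_fderiv_of_contDiffAt_two hf).clm_apply (by fun_prop)
    have := (hD.hasFDerivAt.comp_hasDerivAt (0 : ℝ) (hline 0)).deriv
    rw [h0] at this
    exact this
  have hminφ : IsLocalMin φ 0 := by
    have := htend.eventually hmin
    filter_upwards [this] with s hs
    simpa [hφ] using hs
  have hcφ : ContinuousAt φ 0 := by
    have hfx : ContinuousAt f (x + (0 : ℝ) • v) := by rw [h0]; exact hf.continuousAt
    exact ContinuousAt.comp (f := fun s : ℝ => x + s • v) hfx hcont
  -- The second derivative test makes `0` a local maximum as well, so `φ` is constant near `0` and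
  -- its second derivative vanishes.
  have hmaxφ : IsLocalMax φ 0 :=
    isLocalMax_of_deriv_deriv_neg (by rw [hd2]; exact hneg) hminφ.deriv_eq_zero hcφ
  have hconst : φ =ᶠ[𝓝 0] fun _ => φ 0 := by
    filter_upwards [hminφ, hmaxφ] with s h1 h2
    exact le_antisymm h2 h1
  have hz : deriv (deriv φ) 0 = 0 := by
    rw [hconst.deriv.deriv_eq]
    simp
  rw [hd2] at hz
  exact hneg.ne hz

theorem fderiv_fderiv_apply_nonpos_of_isLocalMax {f : E → ℝ} {x : E} (hmax : IsLocalMax f x)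
    (hf : ContDiffAt ℝ 2 f x) (v : E) : fderiv ℝ (fun y => fderiv ℝ f y v) x v ≤ 0 := by
  have h := fderiv_fderiv_apply_nonneg_of_isLocalMin hmax.neg hf.neg v
  simpa [fderiv_fun_neg] using h

end WarpedGraph

namespace WarpedGraph

/-! ### The warped product metric in coordinates -/

open Filter Topology Bundle

section

variable {n : ℕ} {M : Type*} [TopologicalSpace M]
  [ChartedSpace (EuclideanSpace ℝ (Fin n)) M] [IsManifold (𝓡 n) ∞ M]

/-- The coordinate fields are the tangent map of the inverse chart applied to a constant section;
the inverse chart is `C²`, so its tangent map is `C¹`. -/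
theorem contMDiffAt_mfderiv_extChartAt_symm_apply (u₀ : M) (v : EuclideanSpace ℝ (Fin n)) :
    ContMDiffAt 𝓘(ℝ, EuclideanSpace ℝ (Fin n))
      ((𝓡 n).prod 𝓘(ℝ, EuclideanSpace ℝ (Fin n))) 1
      (fun x => (TotalSpace.mk' (EuclideanSpace ℝ (Fin n)) ((extChartAt (𝓡 n) u₀).symm x)
        (mfderiv 𝓘(ℝ, EuclideanSpace ℝ (Fin n)) (𝓡 n) (extChartAt (𝓡 n) u₀).symm x v) :
          TangentBundle (𝓡 n) M))
      (extChartAt (𝓡 n) u₀ u₀) := by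
  have hopen : IsOpen (extChartAt (𝓡 n) u₀).target := isOpen_extChartAt_target u₀
  have h1 : ContMDiffOn 𝓘(ℝ, EuclideanSpace ℝ (Fin n)) (𝓡 n) 2 (extChartAt (𝓡 n) u₀).symm
      (extChartAt (𝓡 n) u₀).target :=
    (contMDiffOn_extChartAt_symm (n := ∞) u₀).of_le (by norm_cast)
  have : IsManifold (𝓡 n) 1 M := IsManifold.of_le (n := ∞) (by norm_cast)
  have h2 := h1.contMDiffOn_tangentMapWithin (m := 1) (by norm_num) hopen.uniqueMDiffOn
  have h3 : ContMDiffOn 𝓘(ℝ, EuclideanSpace ℝ (Fin n))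
      (𝓘(ℝ, EuclideanSpace ℝ (Fin n)).prod 𝓘(ℝ, EuclideanSpace ℝ (Fin n))) 1
      (fun x => (TotalSpace.mk' (EuclideanSpace ℝ (Fin n)) x v :
        TangentBundle 𝓘(ℝ, EuclideanSpace ℝ (Fin n)) (EuclideanSpace ℝ (Fin n))))
      (extChartAt (𝓡 n) u₀).target := by
    intro x _
    rw [contMDiffWithinAt_totalSpace]
    refine ⟨contMDiffWithinAt_id, ?_⟩
    simpa using contMDiffWithinAt_const
  have h4 := h2.comp h3 (fun x hx => hx)
  have h5 := h4.contMDiffAt (hopen.mem_nhds (mem_extChartAt_target u₀))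
  refine h5.congr_of_eventuallyEq ?_
  filter_upwards [hopen.mem_nhds (mem_extChartAt_target u₀)] with x hx
  simp only [Function.comp_apply, tangentMapWithin, mfderivWithin_of_isOpen hopen hx]

/-- Pairing `C¹` sections with the smooth metric gives `C¹` coefficients. This is what allows the
metric derivative in `christoffel` to be computed, since `fderiv` is `0` by default at points of
non-differentiability. -/
theorem differentiableAt_inner_mfderiv_extChartAt_symm (g : Metric n M) (u₀ : M)
    (v w : EuclideanSpace ℝ (Fin n)) :
    DifferentiableAt ℝ (fun x => g.inner ((extChartAt (𝓡 n) u₀).symm x)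
        (mfderiv 𝓘(ℝ, EuclideanSpace ℝ (Fin n)) (𝓡 n) (extChartAt (𝓡 n) u₀).symm x v)
        (mfderiv 𝓘(ℝ, EuclideanSpace ℝ (Fin n)) (𝓡 n) (extChartAt (𝓡 n) u₀).symm x w))
      (extChartAt (𝓡 n) u₀ u₀) := by
  have hv := contMDiffAt_mfderiv_extChartAt_symm_apply u₀ v
  have hw := contMDiffAt_mfderiv_extChartAt_symm_apply u₀ w
  have hb : ContMDiffAt 𝓘(ℝ, EuclideanSpace ℝ (Fin n)) (𝓡 n) 1 (extChartAt (𝓡 n) u₀).symm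
      (extChartAt (𝓡 n) u₀ u₀) := by
    rw [contMDiffAt_totalSpace] at hv
    exact hv.1
  have hg := (g.contMDiff.of_le (show (1 : ℕ∞ω) ≤ ∞ by norm_cast)).contMDiffAt.comp
    (extChartAt (𝓡 n) u₀ u₀) hb
  have h : ContMDiffAt 𝓘(ℝ, EuclideanSpace ℝ (Fin n)) ((𝓡 n).prod 𝓘(ℝ, ℝ)) 1
      (fun x => TotalSpace.mk' ℝ (E := Bundle.Trivial M ℝ) ((extChartAt (𝓡 n) u₀).symm x)
        (g.inner ((extChartAt (𝓡 n) u₀).symm x)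
        (mfderiv 𝓘(ℝ, EuclideanSpace ℝ (Fin n)) (𝓡 n) (extChartAt (𝓡 n) u₀).symm x v)
        (mfderiv 𝓘(ℝ, EuclideanSpace ℝ (Fin n)) (𝓡 n) (extChartAt (𝓡 n) u₀).symm x w)))
      (extChartAt (𝓡 n) u₀ u₀) := by
    apply ContMDiffAt.clm_bundle_apply₂ (F₁ := EuclideanSpace ℝ (Fin n))
      (F₂ := EuclideanSpace ℝ (Fin n))
    · exact hg
    · exact hv
    · exact hw
  rw [contMDiffAt_totalSpace] at h
  exact (contMDiffAt_iff_contDiffAt.1 h.2).differentiableAt (by simp)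

end

end WarpedGraph

namespace WarpedGraph

/-! ### Fundamental forms of a radial graph at a critical point -/

open Filter Topology Bundle

section

variable {n : ℕ} {M : Type*} [TopologicalSpace M]
  [ChartedSpace (EuclideanSpace ℝ (Fin n)) M]

theorem sum_smul_single (x : Fin n → ℝ) :
    ∑ i, x i • EuclideanSpace.single i (1 : ℝ) = WithLp.toLp 2 x := by
  ext j
  simp [Finset.sum_apply, Pi.single_apply]

/-- The function `r` in the preferred chart at `u₀`. -/
noncomputable def chartRep (r : M → ℝ) (u₀ : M) (x : EuclideanSpace ℝ (Fin n)) : ℝ :=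
  r ((extChartAt (𝓡 n) u₀).symm x)

theorem mfderiv_eq_zero_of_fderiv_chartRep {r : M → ℝ} (hr : ContMDiff (𝓡 n) 𝓘(ℝ, ℝ) 2 r)
    {u₀ : M} (h : fderiv ℝ (chartRep r u₀) (extChartAt (𝓡 n) u₀ u₀) = 0) :
    mfderiv (𝓡 n) 𝓘(ℝ, ℝ) r u₀ = 0 := by
  have hd : MDifferentiableAt (𝓡 n) 𝓘(ℝ, ℝ) r u₀ := hr.mdifferentiable (by simp) u₀
  -- `mfderiv` is a conditional; in the differentiable case it is the derivative of the chart
  -- representative, the chart of the target `ℝ` being the identity.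
  have h' : mfderiv (𝓡 n) 𝓘(ℝ, ℝ) r u₀ = fderivWithin ℝ (chartRep r u₀) (Set.range (𝓡 n))
      (extChartAt (𝓡 n) u₀ u₀) := if_pos hd
  rw [h', ModelWithCorners.range_eq_univ, fderivWithin_univ, h]
  rfl

theorem coordGraph_apply_center (r : M → ℝ) (u₀ : M) :
    coordGraph r u₀ (extChartAt (𝓡 n) u₀ u₀) = (r u₀, extChartAt (𝓡 n) u₀ u₀) := by
  simp [coordGraph]

theorem fderiv_coordGraph_apply {r : M → ℝ} {u₀ : M} {x : EuclideanSpace ℝ (Fin n)}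
    (h : DifferentiableAt ℝ (chartRep r u₀) x) (v : EuclideanSpace ℝ (Fin n)) :
    fderiv ℝ (coordGraph r u₀) x v = (fderiv ℝ (chartRep r u₀) x v, v) := by
  have : HasFDerivAt (coordGraph r u₀) ((fderiv ℝ (chartRep r u₀) x).prod
      (ContinuousLinearMap.id ℝ (EuclideanSpace ℝ (Fin n)))) x :=
    h.hasFDerivAt.prodMk (hasFDerivAt_id x)
  rw [this.fderiv]
  rfl

theorem coordVector_radial (u₀ : M) :
    coordVector u₀ ((1, 0) : AmbientTangent n u₀) = (1, 0) := by
  exact Prod.ext rfl (map_zero (mfderiv (𝓡 n) 𝓘(ℝ, EuclideanSpace ℝ (Fin n))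
    (extChartAt (𝓡 n) u₀) u₀))

theorem isLocalMin_chartRep {r : M → ℝ} {u₀ : M} (h : ∀ u, r u₀ ≤ r u) :
    IsLocalMin (chartRep r u₀) (extChartAt (𝓡 n) u₀ u₀) :=
  Eventually.of_forall fun x => by simpa [chartRep] using h _

theorem isLocalMax_chartRep {r : M → ℝ} {u₀ : M} (h : ∀ u, r u ≤ r u₀) :
    IsLocalMax (chartRep r u₀) (extChartAt (𝓡 n) u₀ u₀) :=
  Eventually.of_forall fun x => by simpa [chartRep] using h _

end

section

variable {n : ℕ} {M : Type*} [TopologicalSpace M]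
  [ChartedSpace (EuclideanSpace ℝ (Fin n)) M] [IsManifold (𝓡 n) ∞ M]

/-- The differential of the inverse of the preferred chart at `u₀`. -/
noncomputable def chartSymmDeriv (u₀ : M) (x : EuclideanSpace ℝ (Fin n)) :
    EuclideanSpace ℝ (Fin n) →L[ℝ] TangentSpace (𝓡 n) ((extChartAt (𝓡 n) u₀).symm x) :=
  mfderiv 𝓘(ℝ, EuclideanSpace ℝ (Fin n)) (𝓡 n) (extChartAt (𝓡 n) u₀).symm x

/-- The metric of `M` in the preferred chart at `u₀`. -/
noncomputable def chartInner (g : Metric n M) (u₀ : M) (x : EuclideanSpace ℝ (Fin n)) :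
    EuclideanSpace ℝ (Fin n) →ₗ[ℝ] EuclideanSpace ℝ (Fin n) →ₗ[ℝ] ℝ :=
  LinearMap.mk₂ ℝ (fun v w => g.inner ((extChartAt (𝓡 n) u₀).symm x)
      (chartSymmDeriv u₀ x v) (chartSymmDeriv u₀ x w))
    (fun v v' w => by rw [map_add, map_add]; rfl)
    (fun c v w => by rw [map_smul, map_smul]; rfl)
    (fun v w w' => by rw [map_add, map_add])
    (fun c v w => by rw [map_smul, map_smul])

theorem chartInner_comm (g : Metric n M) (u₀ : M) (x v w : EuclideanSpace ℝ (Fin n)) :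
    chartInner g u₀ x v w = chartInner g u₀ x w v :=
  g.symm _ _ _

theorem chartInner_self_pos (g : Metric n M) (u₀ : M) {v : EuclideanSpace ℝ (Fin n)}
    (hv : v ≠ 0) : 0 < chartInner g u₀ (extChartAt (𝓡 n) u₀ u₀) v v := by
  apply g.pos
  have : IsManifold (𝓡 n) 1 M := IsManifold.of_le (n := ∞) (by norm_cast)
  have h := isInvertible_mfderivWithin_extChartAt_symm (I := 𝓡 n) (mem_extChartAt_target u₀)
  rw [ModelWithCorners.range_eq_univ, mfderivWithin_univ] at h
  have hinj : Function.Injective (chartSymmDeriv u₀ (extChartAt (𝓡 n) u₀ u₀)) := h.injective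
  exact fun h0 => hv (hinj (h0.trans (map_zero _).symm))

theorem differentiableAt_chartInner (g : Metric n M) (u₀ : M)
    (v w : EuclideanSpace ℝ (Fin n)) :
    DifferentiableAt ℝ (fun x => chartInner g u₀ x v w) (extChartAt (𝓡 n) u₀ u₀) :=
  differentiableAt_inner_mfderiv_extChartAt_symm g u₀ v w

theorem contDiffAt_chartRep {r : M → ℝ} (hr : ContMDiff (𝓡 n) 𝓘(ℝ, ℝ) 2 r) (u₀ : M) :
    ContDiffAt ℝ 2 (chartRep r u₀) (extChartAt (𝓡 n) u₀ u₀) := by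
  rw [← contMDiffAt_iff_contDiffAt]
  have h1 : ContMDiffOn 𝓘(ℝ, EuclideanSpace ℝ (Fin n)) (𝓡 n) 2 (extChartAt (𝓡 n) u₀).symm
      (extChartAt (𝓡 n) u₀).target :=
    (contMDiffOn_extChartAt_symm (n := ∞) u₀).of_le (by norm_cast)
  exact hr.contMDiffAt.comp _
    (h1.contMDiffAt ((isOpen_extChartAt_target u₀).mem_nhds (mem_extChartAt_target u₀)))

/-- Testing orthogonality against the horizontal part of `N` itself gives `lam² |N.2|² = 0`. Then
`N.1² = 1`, and outwardness selects the sign. -/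
theorem IsOutwardUnitNormal.eq_of_mfderiv_eq_zero {lam : ℝ → ℝ} {g : Metric n M} {r : M → ℝ}
    {u : M} {N : AmbientTangent n u} (hN : IsOutwardUnitNormal lam g r u N)
    (hlam : 0 < lam (r u)) (h : mfderiv (𝓡 n) 𝓘(ℝ, ℝ) r u = 0) : N = (1, 0) := by
  have h2 : N.2 = 0 := by
    by_contra hne
    have h1 := hN.orthogonal N.2
    rw [h] at h1
    have h3 := g.pos u N.2 hne
    simp only [ambientInner, zero_apply] at h1
    have h4 : N.1 * (0 : ℝ) + lam (r u) ^ 2 * g.inner u N.2 N.2 = 0 := h1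
    rw [mul_zero, zero_add] at h4
    exact (mul_pos (pow_pos hlam 2) h3).ne' h4
  have h5 := hN.unit
  have h6 := hN.outward
  simp only [ambientInner, h2, map_zero, mul_zero, add_zero, mul_one] at h5 h6
  refine Prod.ext ?_ h2
  nlinarith

theorem coordMetric_apply (lam : ℝ → ℝ) (g : Metric n M) (u₀ : M)
    (p A B : ℝ × EuclideanSpace ℝ (Fin n)) :
    coordMetric lam g u₀ p A B = A.1 * B.1 + lam p.1 ^ 2 * chartInner g u₀ p.2 A.2 B.2 :=
  rfl

theorem coordMetric_horizontal_radial (lam : ℝ → ℝ) (g : Metric n M) (u₀ : M)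
    (p : ℝ × EuclideanSpace ℝ (Fin n)) (w : EuclideanSpace ℝ (Fin n)) :
    coordMetric lam g u₀ p (0, w) (1, 0) = 0 := by
  rw [coordMetric_apply]
  simp

/-- Only the factor `lam²` depends on the radial variable. This term produces the second fundamental
form of the slice. -/
theorem fderiv_coordMetric_horizontal_radial (lam : ℝ → ℝ) (g : Metric n M) (u₀ : M) {ρ : ℝ}
    (hlam : DifferentiableAt ℝ lam ρ) (v w : EuclideanSpace ℝ (Fin n)) :
    fderiv ℝ (fun q => coordMetric lam g u₀ q (0, v) (0, w)) (ρ, extChartAt (𝓡 n) u₀ u₀) (1, 0)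
      = 2 * lam ρ * deriv lam ρ * chartInner g u₀ (extChartAt (𝓡 n) u₀ u₀) v w := by
  have hγ := differentiableAt_chartInner g u₀ v w
  have hline : HasDerivAt (fun s : ℝ => (s, extChartAt (𝓡 n) u₀ u₀))
      ((1 : ℝ), (0 : EuclideanSpace ℝ (Fin n))) ρ :=
    (hasDerivAt_id ρ).prodMk (hasDerivAt_const ρ _)
  have h1 : DifferentiableAt ℝ (fun q : ℝ × EuclideanSpace ℝ (Fin n) => lam q.1)
      (ρ, extChartAt (𝓡 n) u₀ u₀) :=
    DifferentiableAt.comp (g := lam) (ρ, extChartAt (𝓡 n) u₀ u₀) hlam differentiableAt_fst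
  have h2 : DifferentiableAt ℝ
      (fun q : ℝ × EuclideanSpace ℝ (Fin n) => chartInner g u₀ q.2 v w)
      (ρ, extChartAt (𝓡 n) u₀ u₀) :=
    DifferentiableAt.comp (g := fun x => chartInner g u₀ x v w) (ρ, extChartAt (𝓡 n) u₀ u₀) hγ
      differentiableAt_snd
  have h3 := ((hlam.hasDerivAt.fun_pow 2).mul_const
    (chartInner g u₀ (extChartAt (𝓡 n) u₀ u₀) v w)).deriv
  have h4 := (((h1.fun_pow 2).fun_mul h2).hasFDerivAt.comp_hasDerivAt ρ hline).deriv
  simp only [coordMetric_apply, mul_zero, zero_add]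
  rw [← h4]
  -- Along the line `s ↦ (s, x)` the joint derivative is an ordinary derivative in `s`, with the
  -- chart metric frozen.
  refine Eq.trans rfl (h3.trans ?_)
  simp

theorem fderiv_fderiv_coordGraph_apply {r : M → ℝ} (hr : ContMDiff (𝓡 n) 𝓘(ℝ, ℝ) 2 r) (u₀ : M)
    (v w : EuclideanSpace ℝ (Fin n)) :
    fderiv ℝ (fun y => fderiv ℝ (coordGraph r u₀) y w) (extChartAt (𝓡 n) u₀ u₀) v
      = (fderiv ℝ (fun y => fderiv ℝ (chartRep r u₀) y w) (extChartAt (𝓡 n) u₀ u₀) v, 0) := by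
  have hR := contDiffAt_chartRep hr u₀
  have he : (fun y => fderiv ℝ (coordGraph r u₀) y w) =ᶠ[𝓝 (extChartAt (𝓡 n) u₀ u₀)]
      fun y => (fderiv ℝ (chartRep r u₀) y w, w) :=
    (eventually_differentiableAt_of_contDiffAt_two hR).mono
      fun y hy => fderiv_coordGraph_apply hy w
  have hd : DifferentiableAt ℝ (fun y => fderiv ℝ (chartRep r u₀) y w)
      (extChartAt (𝓡 n) u₀ u₀) :=
    (differentiableAt_fderiv_of_contDiffAt_two hR).clm_apply (differentiableAt_const w)
  rw [he.fderiv_eq, (hd.hasFDerivAt.prodMk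
    (hasFDerivAt_const w (extChartAt (𝓡 n) u₀ u₀))).fderiv]
  rfl

theorem firstForm_of_critical (lam : ℝ → ℝ) (g : Metric n M) {r : M → ℝ}
    (hr : ContMDiff (𝓡 n) 𝓘(ℝ, ℝ) 2 r) {u₀ : M}
    (hcrit : fderiv ℝ (chartRep r u₀) (extChartAt (𝓡 n) u₀ u₀) = 0)
    (v w : EuclideanSpace ℝ (Fin n)) :
    firstForm (coordMetric lam g u₀) (coordGraph r u₀) (extChartAt (𝓡 n) u₀ u₀) v w
      = lam (r u₀) ^ 2 * chartInner g u₀ (extChartAt (𝓡 n) u₀ u₀) v w := by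
  have hR := (contDiffAt_chartRep hr u₀).differentiableAt (by simp)
  rw [firstForm, coordGraph_apply_center, fderiv_coordGraph_apply hR, fderiv_coordGraph_apply hR,
    coordMetric_apply, hcrit]
  simp

/-- Tangent vectors are horizontal at a critical point. Horizontal and radial constant fields are
orthogonal everywhere, so two of the three Christoffel terms vanish; the third is `-∂_r(lam² γ)/2 =
-lam lam' γ`, with `γ` the chart metric. The second derivative of the graph is purely radial and
contributes the coordinate Hessian. -/
theorem secondForm_of_critical {lam : ℝ → ℝ} (g : Metric n M) {r : M → ℝ}
    (hr : ContMDiff (𝓡 n) 𝓘(ℝ, ℝ) 2 r) {u₀ : M} (hlam : DifferentiableAt ℝ lam (r u₀))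
    (hcrit : fderiv ℝ (chartRep r u₀) (extChartAt (𝓡 n) u₀ u₀) = 0)
    (v w : EuclideanSpace ℝ (Fin n)) :
    secondForm (coordMetric lam g u₀) (coordGraph r u₀)
        (coordVector u₀ ((1, 0) : AmbientTangent n u₀)) (extChartAt (𝓡 n) u₀ u₀) v w
      = lam (r u₀) * deriv lam (r u₀) * chartInner g u₀ (extChartAt (𝓡 n) u₀ u₀) v w
        - fderiv ℝ (fun y => fderiv ℝ (chartRep r u₀) y w) (extChartAt (𝓡 n) u₀ u₀) v := by
  have hR := (contDiffAt_chartRep hr u₀).differentiableAt (by simp)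
  rw [secondForm, christoffel, coordGraph_apply_center, fderiv_coordGraph_apply hR,
    fderiv_coordGraph_apply hR, fderiv_fderiv_coordGraph_apply hr, coordVector_radial, hcrit]
  simp only [zero_apply, coordMetric_horizontal_radial]
  rw [fderiv_coordMetric_horizontal_radial lam g u₀ hlam, coordMetric_apply]
  simp only [fderiv_fun_const, Pi.zero_apply, zero_apply, map_zero]
  ring

/-- The matrix of the Hessian of `r` in the preferred chart at `u₀`. -/
noncomputable def chartHessian (r : M → ℝ) (u₀ : M) : Matrix (Fin n) (Fin n) ℝ :=
  Matrix.of fun i j => fderiv ℝ (fun y => fderiv ℝ (chartRep r u₀) y (EuclideanSpace.single j 1))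
    (extChartAt (𝓡 n) u₀ u₀) (EuclideanSpace.single i 1)

open Matrix in
theorem dotProduct_mulVec_chartHessian {r : M → ℝ} (hr : ContMDiff (𝓡 n) 𝓘(ℝ, ℝ) 2 r) (u₀ : M)
    (x : Fin n → ℝ) :
    x ⬝ᵥ chartHessian r u₀ *ᵥ x
      = fderiv ℝ (fun y => fderiv ℝ (chartRep r u₀) y (WithLp.toLp 2 x))
        (extChartAt (𝓡 n) u₀ u₀) (WithLp.toLp 2 x) := by
  have hd := differentiableAt_fderiv_of_contDiffAt_two (contDiffAt_chartRep hr u₀)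
  have hB : ∀ v w, fderiv ℝ (fun y => fderiv ℝ (chartRep r u₀) y w) (extChartAt (𝓡 n) u₀ u₀) v
      = fderiv ℝ (fderiv ℝ (chartRep r u₀)) (extChartAt (𝓡 n) u₀ u₀) v w := by
    intro v w
    rw [fderiv_clm_apply hd (differentiableAt_const w)]
    simp
  rw [hB, ← sum_smul_single]
  simp only [chartHessian, hB, map_sum, map_smul, _root_.sum_apply, _root_.smul_apply, dotProduct, mulVec,
    of_apply, Finset.mul_sum, smul_eq_mul]
  rw [Finset.sum_comm]
  refine Finset.sum_congr rfl fun i _ => Finset.sum_congr rfl fun j _ => ?_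
  ring

theorem isHermitian_chartHessian {r : M → ℝ} (hr : ContMDiff (𝓡 n) 𝓘(ℝ, ℝ) 2 r) (u₀ : M) :
    (chartHessian (n := n) r u₀).IsHermitian := by
  refine Matrix.IsHermitian.ext fun i j => ?_
  simpa [chartHessian] using fderiv_fderiv_apply_comm (contDiffAt_chartRep hr u₀) _ _

open Matrix in
theorem posDef_gMatrix_of_critical {lam : ℝ → ℝ} (g : Metric n M) {r : M → ℝ}
    (hr : ContMDiff (𝓡 n) 𝓘(ℝ, ℝ) 2 r) {u₀ : M} (hlam : 0 < lam (r u₀))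
    (hcrit : fderiv ℝ (chartRep r u₀) (extChartAt (𝓡 n) u₀ u₀) = 0) :
    (gMatrix lam g r u₀).PosDef := by
  rw [posDef_iff_dotProduct_mulVec]
  constructor
  · ext i j
    simp only [gMatrix, conjTranspose_apply, of_apply, star_trivial]
    rw [firstForm_of_critical lam g hr hcrit, firstForm_of_critical lam g hr hcrit,
      chartInner_comm]
  · intro x hx
    have hx' : WithLp.toLp 2 x ≠ (0 : EuclideanSpace ℝ (Fin n)) := by
      simpa using hx
    have h : star x ⬝ᵥ gMatrix lam g r u₀ *ᵥ x
        = lam (r u₀) ^ 2 * chartInner g u₀ (extChartAt (𝓡 n) u₀ u₀)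
          (WithLp.toLp 2 x) (WithLp.toLp 2 x) := by
      simp only [gMatrix, star_trivial, dotProduct, mulVec, of_apply,
        firstForm_of_critical lam g hr hcrit]
      simp only [← sum_smul_single, map_sum, map_smul, LinearMap.sum_apply, LinearMap.smul_apply,
        Finset.mul_sum, smul_eq_mul]
      rw [Finset.sum_comm]
      refine Finset.sum_congr rfl fun i _ => Finset.sum_congr rfl fun j _ => ?_
      ring
    rw [h]
    exact mul_pos (pow_pos hlam 2) (chartInner_self_pos g u₀ hx')

theorem hMatrix_of_critical {lam : ℝ → ℝ} (g : Metric n M) {r : M → ℝ}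
    (hr : ContMDiff (𝓡 n) 𝓘(ℝ, ℝ) 2 r) {u₀ : M} (hlam : 0 < lam (r u₀))
    (hlamd : DifferentiableAt ℝ lam (r u₀))
    (hcrit : fderiv ℝ (chartRep r u₀) (extChartAt (𝓡 n) u₀ u₀) = 0) :
    hMatrix lam g r u₀ (1, 0)
      = (deriv lam (r u₀) / lam (r u₀)) • gMatrix lam g r u₀ - chartHessian r u₀ := by
  ext i j
  simp only [hMatrix, gMatrix, chartHessian, Matrix.of_apply, Matrix.sub_apply, Matrix.smul_apply,
    smul_eq_mul]
  rw [secondForm_of_critical g hr hlamd hcrit, firstForm_of_critical lam g hr hcrit]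
  have hne := hlam.ne'
  field_simp

/-- At a critical point of `r` the eigenvalues of `g⁻¹ η` are those of the slice, shifted by the
Hessian of `r`. -/
theorem exists_etaEigenvalues_eq_of_critical {lam : ℝ → ℝ} (g : Metric n M) {r : M → ℝ}
    (hr : ContMDiff (𝓡 n) 𝓘(ℝ, ℝ) 2 r) {u₀ : M} (hlam : 0 < lam (r u₀))
    (hlamd : DifferentiableAt ℝ lam (r u₀))
    (hcrit : fderiv ℝ (chartRep r u₀) (extChartAt (𝓡 n) u₀ u₀) = 0)
    {N : AmbientTangent n u₀} (hN : IsOutwardUnitNormal lam g r u₀ N) :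
    ∃ q : Fin n → ℝ,
      etaEigenvalues lam g r u₀ N = Finset.univ.val.map (fun i =>
        ((n : ℝ) - 1) * (deriv lam (r u₀) / lam (r u₀)) - (∑ j, q j - q i)) ∧
      ∀ i, ∃ v : EuclideanSpace ℝ (Fin n), q i = fderiv ℝ
        (fun y => fderiv ℝ (chartRep r u₀) y v) (extChartAt (𝓡 n) u₀ u₀) v := by
  obtain rfl := hN.eq_of_mfderiv_eq_zero hlam (mfderiv_eq_zero_of_fderiv_chartRep hr hcrit)
  obtain ⟨q, hq, hq'⟩ := exists_roots_charpoly_eta (posDef_gMatrix_of_critical g hr hlam hcrit)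
    (isHermitian_chartHessian hr u₀) (deriv lam (r u₀) / lam (r u₀))
  refine ⟨q, ?_, fun i => ?_⟩
  · rw [etaEigenvalues, etaMatrix, meanCurvature, hMatrix_of_critical g hr hlam hlamd hcrit, hq,
      Fintype.card_fin]
  · obtain ⟨x, hx⟩ := hq' i
    exact ⟨WithLp.toLp 2 x, by rw [hx, dotProduct_mulVec_chartHessian hr]⟩

theorem sum_sub_eq_sum_erase (q : Fin n → ℝ) (i : Fin n) :
    ∑ j, q j - q i = ∑ j ∈ Finset.univ.erase i, q j := by
  rw [← Finset.sum_erase_add _ _ (Finset.mem_univ i), add_sub_cancel_right]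

theorem barrier_pos {k l : ℕ} (hn : 2 ≤ n) (hkn : k ≤ n) (hl : l ≤ k) {lam : ℝ → ℝ} {ρ : ℝ}
    (h : 0 < lam ρ) (h' : 0 < deriv lam ρ) : 0 < barrier n k l lam ρ := by
  have h1 : (0 : ℝ) < n.choose k := by exact_mod_cast Nat.choose_pos hkn
  have h2 : (0 : ℝ) < n.choose l := by exact_mod_cast Nat.choose_pos (hl.trans hkn)
  have h3 : (0 : ℝ) < (n : ℝ) - 1 := by
    have : (2 : ℝ) ≤ n := by exact_mod_cast hn
    linarith
  exact mul_pos (div_pos h1 h2) (pow_pos (mul_pos h3 (div_pos h' h)) _)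

/-- At a minimum of `r` the curvature quotient is at most that of the slice. -/
theorem esymm_quotient_le_barrier {k l : ℕ} (hn : 2 ≤ n) (hkn : k ≤ n) (hl : l ≤ k)
    {lam : ℝ → ℝ} (g : Metric n M) {r : M → ℝ} (hr : ContMDiff (𝓡 n) 𝓘(ℝ, ℝ) 2 r) {u₀ : M}
    (hlam : 0 < lam (r u₀)) (hlam' : 0 < deriv lam (r u₀))
    {N : AmbientTangent n u₀} (hN : IsOutwardUnitNormal lam g r u₀ N)
    (hconvex : InGardingCone k (etaEigenvalues lam g r u₀ N)) (hmin : ∀ u, r u₀ ≤ r u) :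
    (etaEigenvalues lam g r u₀ N).esymm k / (etaEigenvalues lam g r u₀ N).esymm l
      ≤ barrier n k l lam (r u₀) := by
  have hm := isLocalMin_chartRep (n := n) hmin
  -- A nonzero value of `deriv` already forces differentiability, because its default value is `0`.
  obtain ⟨q, hq, hq'⟩ := exists_etaEigenvalues_eq_of_critical g hr hlam
    (differentiableAt_of_deriv_ne_zero hlam'.ne') hm.fderiv_eq_zero hN
  have hq0 : ∀ i, 0 ≤ q i := fun i => by
    obtain ⟨v, hv⟩ := hq' i
    rw [hv]
    exact fderiv_fderiv_apply_nonneg_of_isLocalMin hm (contDiffAt_chartRep hr u₀) v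
  have hcard : Multiset.card (etaEigenvalues lam g r u₀ N) = n := by simp [hq]
  have hn1 : (0 : ℝ) < (n : ℝ) - 1 := by
    have : (2 : ℝ) ≤ n := by exact_mod_cast hn
    linarith
  -- Each eigenvalue is `(n-1) ζ` minus a sum of nonnegative `q j`, so `(n-1) ζ` is a common upper
  -- bound.
  have h := hconvex.esymm_quotient_le (by rw [hcard]; exact hkn) hl
    (mul_pos hn1 (div_pos hlam' hlam)) (fun a ha => by
      rw [hq] at ha
      obtain ⟨i, -, rfl⟩ := Multiset.mem_map.1 ha
      rw [sum_sub_eq_sum_erase]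
      exact sub_le_self _ (Finset.sum_nonneg fun j _ => hq0 j))
  rwa [hcard] at h

/-- At a maximum of `r` the curvature quotient is at least that of the slice. -/
theorem barrier_le_esymm_quotient {k l : ℕ} (hn : 2 ≤ n) (hkn : k ≤ n) (hl : l ≤ k)
    {lam : ℝ → ℝ} (g : Metric n M) {r : M → ℝ} (hr : ContMDiff (𝓡 n) 𝓘(ℝ, ℝ) 2 r) {u₀ : M}
    (hlam : 0 < lam (r u₀)) (hlam' : 0 < deriv lam (r u₀))
    {N : AmbientTangent n u₀} (hN : IsOutwardUnitNormal lam g r u₀ N)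
    (hconvex : InGardingCone k (etaEigenvalues lam g r u₀ N)) (hmax : ∀ u, r u ≤ r u₀) :
    barrier n k l lam (r u₀)
      ≤ (etaEigenvalues lam g r u₀ N).esymm k / (etaEigenvalues lam g r u₀ N).esymm l := by
  have hm := isLocalMax_chartRep (n := n) hmax
  obtain ⟨q, hq, hq'⟩ := exists_etaEigenvalues_eq_of_critical g hr hlam
    (differentiableAt_of_deriv_ne_zero hlam'.ne') hm.fderiv_eq_zero hN
  have hq0 : ∀ i, q i ≤ 0 := fun i => by
    obtain ⟨v, hv⟩ := hq' i
    rw [hv]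
    exact fderiv_fderiv_apply_nonpos_of_isLocalMax hm (contDiffAt_chartRep hr u₀) v
  have hcard : Multiset.card (etaEigenvalues lam g r u₀ N) = n := by simp [hq]
  have hn1 : (0 : ℝ) < (n : ℝ) - 1 := by
    have : (2 : ℝ) ≤ n := by exact_mod_cast hn
    linarith
  -- The subtracted sums are now nonpositive, so `(n-1) ζ` is a common lower bound.
  have h := hconvex.le_esymm_quotient (by rw [hcard]; exact hkn) hl
    (mul_pos hn1 (div_pos hlam' hlam)) (fun a ha => by
      rw [hq] at ha
      obtain ⟨i, -, rfl⟩ := Multiset.mem_map.1 ha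
      rw [sum_sub_eq_sum_erase]
      linarith [Finset.sum_nonpos (s := Finset.univ.erase i) fun j _ => hq0 j])
  rwa [hcard] at h

end

end WarpedGraph

/-! ### The barrier argument at the extrema of `r` -/

theorem mainTheorem4
    {n k l : ℕ} (hk : 2 ≤ k) (hkn : k ≤ n) (hl : l + 2 ≤ k)
    {M : Type*} [TopologicalSpace M] [ChartedSpace (EuclideanSpace ℝ (Fin n)) M]
    [IsManifold (𝓡 n) ∞ M] [CompactSpace M]
    -- the Riemannian metric on `M` and the warped product `I ×_lam M`
    (g : WarpedGraph.Metric n M)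
    (I : Set ℝ) (hIo : IsOpen I) (hIc : I.OrdConnected)
    (lam : ℝ → ℝ) (hlam : ContDiffOn ℝ 2 lam I)
    (hlam_pos : ∀ ρ ∈ I, 0 < lam ρ) (hlam_deriv : ∀ ρ ∈ I, 0 < deriv lam ρ)
    (r₁ r₂ : ℝ) (hr : r₁ < r₂)
    -- the prescribed function `f(ρ, u, ν)` on a set `Γ` of vectors, and the barrier conditions
    (Γ : ℝ → (u : M) → Set (WarpedGraph.AmbientTangent n u))
    (f : ℝ → (u : M) → WarpedGraph.AmbientTangent n u → ℝ)
    (hf₁ : ∀ ρ ∈ I, ρ ≤ r₁ → ∀ (u : M), ∀ N ∈ Γ ρ u,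
      WarpedGraph.ambientInner lam g ρ u N N = 1 →
        WarpedGraph.barrier n k l lam ρ < f ρ u N)
    (hf₂ : ∀ ρ ∈ I, r₂ ≤ ρ → ∀ (u : M), ∀ N ∈ Γ ρ u,
      WarpedGraph.ambientInner lam g ρ u N N = 1 →
        f ρ u N < WarpedGraph.barrier n k l lam ρ)
    (φ : ℝ → ℝ) (hφ : WarpedGraph.IsHomotopyWeight I r₁ r₂ φ)
    (t : ℝ) (ht : t ∈ Set.Ioc (0 : ℝ) 1)
    -- the radial graph of `r` and its outward unit normal `ν`
    (r : M → ℝ) (hr_smooth : ContMDiff (𝓡 n) 𝓘(ℝ, ℝ) 2 r) (hrI : ∀ u, r u ∈ I)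
    (ν : (u : M) → WarpedGraph.AmbientTangent n u)
    (hν : ∀ u, WarpedGraph.IsOutwardUnitNormal lam g r u (ν u))
    (hνΓ : ∀ u, ν u ∈ Γ (r u) u)
    -- the graph is `(η, k)`-convex and solves the equation
    (hconvex : ∀ u, WarpedGraph.InGardingCone k (WarpedGraph.etaEigenvalues lam g r u (ν u)))
    (heq : ∀ u,
      (WarpedGraph.etaEigenvalues lam g r u (ν u)).esymm k /
          (WarpedGraph.etaEigenvalues lam g r u (ν u)).esymm l =
        t * f (r u) u (ν u) + (1 - t) * φ (r u) * WarpedGraph.barrier n k l lam (r u)) :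
    ∀ u, r₁ < r u ∧ r u < r₂ := by
  intro u
  have hn : 2 ≤ n := hk.trans hkn
  have hlk : l ≤ k := by omega
  have hcont : Continuous r := hr_smooth.continuous
  have : Nonempty M := ⟨u⟩
  obtain ⟨a, -, ha⟩ := isCompact_univ.exists_isMinOn Set.univ_nonempty hcont.continuousOn
  obtain ⟨b, -, hb⟩ := isCompact_univ.exists_isMaxOn Set.univ_nonempty hcont.continuousOn
  have ha' : ∀ v, r a ≤ r v := fun v => ha (Set.mem_univ v)
  have hb' : ∀ v, r v ≤ r b := fun v => hb (Set.mem_univ v)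
  constructor
  · refine lt_of_lt_of_le ?_ (ha' u)
    by_contra! hle
    have h1 := WarpedGraph.esymm_quotient_le_barrier hn hkn hlk g hr_smooth
      (hlam_pos _ (hrI a)) (hlam_deriv _ (hrI a)) (hν a) (hconvex a) ha'
    have h2 := hf₁ _ (hrI a) hle a (ν a) (hνΓ a) (hν a).unit
    have h3 := hφ.one_le _ (hrI a) hle
    have h4 := WarpedGraph.barrier_pos hn hkn hlk (hlam_pos _ (hrI a)) (hlam_deriv _ (hrI a))
    rw [heq a] at h1
    -- Positivity of `t` keeps the inequality strict. Adding `t (f - b) > 0` and `(1 - t)(φ - 1) b ≥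
    -- 0` gives `f^t > b`, contrary to `h1`.
    have h5 := mul_lt_mul_of_pos_left h2 ht.1
    have h6 := mul_nonneg (sub_nonneg.2 ht.2) (mul_nonneg (sub_nonneg.2 h3) h4.le)
    nlinarith
  · refine lt_of_le_of_lt (hb' u) ?_
    by_contra! hle
    have h1 := WarpedGraph.barrier_le_esymm_quotient hn hkn hlk g hr_smooth
      (hlam_pos _ (hrI b)) (hlam_deriv _ (hrI b)) (hν b) (hconvex b) hb'
    have h2 := hf₂ _ (hrI b) hle b (ν b) (hνΓ b) (hν b).unit
    have h3 := hφ.le_one _ (hrI b) hle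
    have h4 := WarpedGraph.barrier_pos hn hkn hlk (hlam_pos _ (hrI b)) (hlam_deriv _ (hrI b))
    rw [heq b] at h1
    have h5 := mul_lt_mul_of_pos_left h2 ht.1
    -- At the maximum the weight enters through `(1 - t)(1 - φ) b ≥ 0`, so that `f^t < b`.
    have h6 := mul_nonneg (sub_nonneg.2 ht.2) (mul_nonneg (sub_nonneg.2 h3) h4.le)
    nlinarith
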